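/- Let $G=(V,E)$ be a simple undirected graph with $n=|V|$ vertices and clique number $\omega(G)$. A set $X\subseteq V$ is monophonically convex if, for all distinct $u,v\in X$, every vertex lying on an induced (chordless) path between $u$ and $v$ belongs to $X$; it is a monophonic halfspace (m-halfspace) if both $X$ and $V\setminus X$ are monophonically convex. Let $\mathcal{H}_{\mathrm m}(G)$ be the set of all m-halfspaces of $G$. In agnostic online learning over $\mathcal{H}_{\mathrm m}(G)$ the learner is given $G$. In each round $t=1,\dots,T$ it is shown a vertex $v_t\in V$, predicts a label $\hat y_t\in\{0,1\}$, is then told the true label $y_t\in\{0,1\}$, and has made a mistake if $\hat y_t\neq y_t$. The sequence $(v_1,y_1),\dots,(v_T,y_T)$ is arbitrary (in particular the labels may come from an arbitrary function $f:V\to\{0,1\}$). Let $$M^*=\min_{H\in\mathcal{H}_{\mathrm m}(G)}\bigl|\{t\le T : \mathbf 1_{v_t\in H}\neq y_t\}\bigr|$$ be the minimum number of mistakes that an m-halfspace makes on the sequence. \textbf{Theorem.} There are a deterministic algorithm (a single random access machine program, with logarithmic cost), a polynomial $p$ and a constant $C$ such that, for every connected graph $G$ with $n\ge 2$ vertices,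 the algorithm, given $G$ in the form of its adjacency matrix, preprocesses $G$ in time at most $p(n)$, uses time at most $p(n)$ in each round, and on every finite sequence $(v_1,y_1),\dots,(v_T,y_T)$ in $V\times\{0,1\}$ makes at most $$C\,\omega(G)\,\bigl(M^*+\log n\bigr)$$ mistakes. The algorithm is told neither $T$, nor $M^*$, nor $\omega(G)$. -/

import Mathlib

/-! ### Monophonic convexity in graphs -/

namespace SimpleGraph

variable {V : Type*}

/-- The monophonic interval between `u` and `v`: all vertices lying on an induced (that is,
chordless) path between `u` and `v` if `u ≠ v`, and the empty set if `u = v`. -/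
def mInterval (G : SimpleGraph V) (u v : V) : Set V :=
  {z | u ≠ v ∧ ∃ p : G.Walk u v, p.IsPath ∧ p.IsChordless ∧ z ∈ p.support}

/-- Monophonically convex vertex sets. -/
def IsMConvex (G : SimpleGraph V) (X : Set V) : Prop :=
  ∀ u ∈ X, ∀ v ∈ X, G.mInterval u v ⊆ X

/-- Monophonic halfspaces: the set and its complement are both monophonically convex. -/
def IsMHalfspace (G : SimpleGraph V) (H : Set V) : Prop :=
  G.IsMConvex H ∧ G.IsMConvex Hᶜ

/-- The family of all monophonic halfspaces of `G`. -/
def mHalfspaces (G : SimpleGraph V) : Set (Set V) :=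
  {H | G.IsMHalfspace H}

theorem empty_mem_mHalfspaces (G : SimpleGraph V) : (∅ : Set V) ∈ G.mHalfspaces := by
  refine ⟨?_, ?_⟩
  · intro u hu
    exact absurd hu (Set.notMem_empty u)
  · intro u _ v _
    simp

end SimpleGraph

/-! ### Labelled sequences and the best halfspace in hindsight -/

open Classical in
/-- The number of rounds of the labelled sequence `S` in which the fixed hypothesis `H`
(predicting the label `true` exactly on its members) errs. -/
noncomputable def hypothesisMistakes {V : Type*} (H : Set V) (S : List (V × Bool)) : ℕ :=
  S.countP fun r => decide (r.1 ∈ H) != r.2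

/-- The minimum number of mistakes that a monophonic halfspace of `G` makes on `S`. -/
noncomputable def optMistakes {V : Type*} (G : SimpleGraph V) (S : List (V × Bool)) : ℕ :=
  sInf ((fun H => hypothesisMistakes H S) '' G.mHalfspaces)

/-- The minimum is over a nonempty set, hence attained. -/
theorem exists_hypothesisMistakes_eq_optMistakes {V : Type*} (G : SimpleGraph V)
    (S : List (V × Bool)) :
    ∃ H ∈ G.mHalfspaces, hypothesisMistakes H S = optMistakes G S :=
  Nat.sInf_mem (Set.Nonempty.image _ ⟨∅, G.empty_mem_mHalfspaces⟩)

/-! ### Random access machines with logarithmic cost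

Programs are finite objects: a structured programming language over scalar variables and arrays,
all holding natural numbers. Reading an array is indirect addressing. Every operation is charged
according to the bit length of the numbers it handles. -/

namespace RAM

/-- Memory contents: scalar variables and arrays. A program mentions finitely many of either. -/
structure State where
  var : ℕ → ℕ
  arr : ℕ → ℕ → ℕ

/-- Set the variable `x` to `k`. -/
def State.setVar (σ : State) (x k : ℕ) : State :=
  { σ with var := Function.update σ.var x k }

/-- Set the entry with index `i` of the array `a` to `k`. -/
def State.setArr (σ : State) (a i k : ℕ) : State :=
  { σ with arr := Function.update σ.arr a (Function.update (σ.arr a) i k) }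

/-- Binary operations: addition, truncated subtraction, multiplication, integer division
(division by `0` gives `0`). -/
inductive Op
  | add | sub | mul | div

def Op.eval : Op → ℕ → ℕ → ℕ
  | add, k, l => k + l
  | sub, k, l => k - l
  | mul, k, l => k * l
  | div, k, l => k / l

/-- Expressions: constants, variables, array entries, binary operations. -/
inductive Expr
  | const (k : ℕ)
  | var (x : ℕ)
  | read (a : ℕ) (i : Expr)
  | bin (o : Op) (e f : Expr)

/-- The value of an expression. -/
def Expr.eval (σ : State) : Expr → ℕ
  | const k => k
  | var x => σ.var x
  | read a i => σ.arr a (i.eval σ)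
  | bin o e f => o.eval (e.eval σ) (f.eval σ)

/-- The cost of evaluating an expression: every node of the expression costs one plus the bit
length of its value. -/
def Expr.cost (σ : State) : Expr → ℕ
  | const k => 1 + Nat.size k
  | var x => 1 + Nat.size (σ.var x)
  | read a i => i.cost σ + (1 + Nat.size (σ.arr a (i.eval σ)))
  | bin o e f => e.cost σ + f.cost σ + (1 + Nat.size (o.eval (e.eval σ) (f.eval σ)))

/-- Programs. A test succeeds if the value of its expression is nonzero. -/
inductive Prog
  | skip
  | assign (x : ℕ) (e : Expr)
  | write (a : ℕ) (i e : Expr)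
  | seq (P Q : Prog)
  | cond (e : Expr) (P Q : Prog)
  | loop (e : Expr) (P : Prog)

/-- `Exec P σ t σ'`: the program `P`, started with memory contents `σ`, halts at cost `t` with
memory contents `σ'`. -/
inductive Exec : Prog → State → ℕ → State → Prop
  | skip (σ : State) : Exec .skip σ 1 σ
  | assign (x : ℕ) (e : Expr) (σ : State) :
      Exec (.assign x e) σ (e.cost σ + 1) (σ.setVar x (e.eval σ))
  | write (a : ℕ) (i e : Expr) (σ : State) :
      Exec (.write a i e) σ (i.cost σ + e.cost σ + 1) (σ.setArr a (i.eval σ) (e.eval σ))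
  | seq {P Q : Prog} {σ σ₁ σ₂ : State} {t₁ t₂ : ℕ} :
      Exec P σ t₁ σ₁ → Exec Q σ₁ t₂ σ₂ → Exec (.seq P Q) σ (t₁ + t₂) σ₂
  | cond_true {e : Expr} {P Q : Prog} {σ σ₁ : State} {t : ℕ} :
      e.eval σ ≠ 0 → Exec P σ t σ₁ → Exec (.cond e P Q) σ (e.cost σ + 1 + t) σ₁
  | cond_false {e : Expr} {P Q : Prog} {σ σ₁ : State} {t : ℕ} :
      e.eval σ = 0 → Exec Q σ t σ₁ → Exec (.cond e P Q) σ (e.cost σ + 1 + t) σ₁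
  | loop_true {e : Expr} {P : Prog} {σ σ₁ σ₂ : State} {t₁ t₂ : ℕ} :
      e.eval σ ≠ 0 → Exec P σ t₁ σ₁ → Exec (.loop e P) σ₁ t₂ σ₂ →
      Exec (.loop e P) σ (e.cost σ + 1 + t₁ + t₂) σ₂
  | loop_false {e : Expr} {P : Prog} {σ : State} :
      e.eval σ = 0 → Exec (.loop e P) σ (e.cost σ + 1) σ

/-- Execution is deterministic: the cost and the final memory contents are unique. -/
theorem Exec.unique {P : Prog} {σ σ₁ σ₂ : State} {t₁ t₂ : ℕ}
    (h₁ : Exec P σ t₁ σ₁) (h₂ : Exec P σ t₂ σ₂) : t₁ = t₂ ∧ σ₁ = σ₂ := by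
  induction h₁ generalizing t₂ σ₂ with
  | skip | assign | write => cases h₂; exact ⟨rfl, rfl⟩
  | seq _ _ ih₁ ih₂ =>
    cases h₂ with
    | seq a b =>
      obtain ⟨rfl, rfl⟩ := ih₁ a
      obtain ⟨rfl, rfl⟩ := ih₂ b
      exact ⟨rfl, rfl⟩
  | cond_true h _ ih =>
    cases h₂ with
    | cond_true _ a => obtain ⟨rfl, rfl⟩ := ih a; exact ⟨rfl, rfl⟩
    | cond_false h' _ => exact absurd h' h
  | cond_false h _ ih =>
    cases h₂ with
    | cond_true h' _ => exact absurd h h'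
    | cond_false _ a => obtain ⟨rfl, rfl⟩ := ih a; exact ⟨rfl, rfl⟩
  | loop_true h _ _ ih₁ ih₂ =>
    cases h₂ with
    | loop_true _ a b =>
      obtain ⟨rfl, rfl⟩ := ih₁ a
      obtain ⟨rfl, rfl⟩ := ih₂ b
      exact ⟨rfl, rfl⟩
    | loop_false h' => exact absurd h' h
  | loop_false h =>
    cases h₂ with
    | loop_true h' _ _ => exact absurd h h'
    | loop_false _ => exact ⟨rfl, rfl⟩

end RAM

/-! ### Online learners -/

open RAM

/-- An online learning algorithm: a program run once on the graph, before the first round; a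
program that, in each round, computes the prediction from the presented vertex; and a program
run after the true label of that vertex is revealed. The memory persists throughout. -/
structure OnlineAlgorithm where
  setup : Prog
  predict : Prog
  update : Prog

open Classical in
/-- The initial memory, presenting a graph on `n` vertices: variable `0` holds `n` and array `0`
holds the adjacency matrix row by row; everything else is `0`. -/
noncomputable def graphInput {n : ℕ} (G : SimpleGraph (Fin n)) : State where
  var x := if x = 0 then n else 0
  arr a k := if a = 0 ∧ ∃ i j : Fin n, k = i * n + j ∧ G.Adj i j then 1 else 0

/-- `A.Plays τ σ S k`: starting from memory `σ`, the algorithm `A` plays the rounds listed in `S`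
(vertex and true label), spends time at most `τ` in each single round, and makes exactly `k`
mistakes. In each round the vertex is put into variable `1`; then the prediction is computed and
left in variable `2` (nonzero for the label `true`); only then is the true label put into
variable `3`, and the update is run. -/
def OnlineAlgorithm.Plays (A : OnlineAlgorithm) (τ : ℕ) {n : ℕ} :
    State → List (Fin n × Bool) → ℕ → Prop
  | _, [], k => k = 0
  | σ, (v, y) :: S, k =>
      ∃ (σ₁ σ₂ : State) (t₁ t₂ l : ℕ),
        Exec A.predict (σ.setVar 1 v) t₁ σ₁ ∧
        Exec A.update (σ₁.setVar 3 y.toNat) t₂ σ₂ ∧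
        t₁ + t₂ ≤ τ ∧
        A.Plays τ σ₂ S l ∧
        k = (if decide (σ₁.var 2 ≠ 0) = y then 0 else 1) + l

/-- The number of mistakes is determined by the algorithm, the memory and the sequence. -/
theorem OnlineAlgorithm.Plays.unique {A : OnlineAlgorithm} {τ τ' n : ℕ} {σ : State}
    {S : List (Fin n × Bool)} {k k' : ℕ} (h : A.Plays τ σ S k) (h' : A.Plays τ' σ S k') :
    k = k' := by
  induction S generalizing σ k k' with
  | nil => exact Eq.trans h (Eq.symm h')
  | cons r S ih =>
    obtain ⟨σ₁, σ₂, t₁, t₂, l, h₁, h₂, -, hS, rfl⟩ := h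
    obtain ⟨ρ₁, ρ₂, s₁, s₂, m, g₁, g₂, -, gS, rfl⟩ := h'
    obtain ⟨-, rfl⟩ := h₁.unique g₁
    obtain ⟨-, rfl⟩ := h₂.unique g₂
    rw [ih hS gS]

/-! ### Chordless paths -/

namespace SimpleGraph

variable {V : Type*} {G : SimpleGraph V}

namespace Walk

/-! Fix a halfspace H of a connected graph. Its boundary vertices, those with a neighbour outside H,
form a clique (`IsMHalfspace.adj_of_boundary`), so there are at most ω of them. For each boundary
vertex a choose a neighbour b outside H, and let the shadow of (a, b) consist of the vertices
reached from a by walks that avoid, after a, the closed neighbourhood of b. Convexity of the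
complement keeps the shadow inside H. Conversely, a walk from a vertex of H to the outside meets a
first boundary vertex a, and the vertices before it have no neighbour outside H, so the walk's start
lies in the shadow of a. Hence H is a union of at most ω shadows
(`IsMHalfspace.exists_shadow_cover`). The case H = V is covered by a non-adjacent pair, whose shadow
is everything by convention.

The shadows do not depend on H: there are N = n² pairs, and every halfspace is a monotone
disjunction of at most ω of the N attributes "v lies in the shadow of (a, b)". Winnow with threshold
2N learns such disjunctions K agnostically. With W the sum of all weights 2 ^ e k, the potential 2W
- 5N ∑_{k ∈ K} e k falls by at least N at each mistake, except that an error of the disjunction may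
cost 5N(|K| + 1) (`Winnow.potential_step`). Weights stay integers between 1 and 4N, so the mistakes
number O(|K| log N + (|K| + 1) M*), and the time of a round does not grow with T.

The rest verifies a program: the shadows are tabulated by n relaxation sweeps, and all numbers
involved are polynomially bounded. -/

theorem IsChordless.cons {u w v : V} (h : G.Adj u w) {q : G.Walk w v} (hq : q.IsChordless)
    (hw : ∀ x ∈ q.support, G.Adj u x → x = w) : (Walk.cons h q).IsChordless := by
  rw [isChordless_iff_forall_mem_edges] at hq ⊢
  intro x y hx hy hxy
  rw [support_cons, List.mem_cons] at hx hy
  rw [edges_cons, List.mem_cons]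
  rcases hx with rfl | hx <;> rcases hy with rfl | hy
  · exact absurd hxy (G.loopless.irrefl _)
  · rw [hw y hy hxy]; exact Or.inl rfl
  · rw [hw x hx hxy.symm]; exact Or.inl Sym2.eq_swap
  · exact Or.inr (hq hx hy hxy)

/-- The removed edge cannot serve as an edge between two vertices of q, since its endpoint u is not
on q; this is where the path hypothesis enters. -/
theorem IsChordless.of_cons {u w v : V} {h : G.Adj u w} {q : G.Walk w v}
    (hp : (Walk.cons h q).IsPath) (hc : (Walk.cons h q).IsChordless) : q.IsChordless := by
  rw [isChordless_iff_forall_mem_edges] at hc ⊢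
  rw [cons_isPath_iff] at hp
  intro x y hx hy hxy
  have := hc (List.mem_cons_of_mem _ hx) (List.mem_cons_of_mem _ hy) hxy
  rw [edges_cons, List.mem_cons] at this
  rcases this with h' | h'
  · rw [Sym2.eq_iff] at h'
    rcases h' with ⟨rfl, -⟩ | ⟨-, rfl⟩
    · exact absurd hx hp.2
    · exact absurd hy hp.2
  · exact h'

theorem exists_chordless_suffix {w v : V} (q : G.Walk w v) (hp : q.IsPath) (hc : q.IsChordless)
    {u : V} (hu : u ∈ q.support) :
    ∃ r : G.Walk u v, r.IsPath ∧ r.IsChordless ∧ r.support ⊆ q.support := by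
  induction q with
  | nil =>
    rw [support_nil, List.mem_singleton] at hu
    subst hu
    exact ⟨nil, hp, hc, fun _ h => h⟩
  | cons h q ih =>
    rw [support_cons, List.mem_cons] at hu
    rcases hu with rfl | hu
    · exact ⟨_, hp, hc, fun _ h => h⟩
    · obtain ⟨r, h₁, h₂, h₃⟩ := ih hp.of_cons (IsChordless.of_cons hp hc) hu
      exact ⟨r, h₁, h₂, fun x hx => List.mem_cons_of_mem _ (h₃ hx)⟩

/-- Attach u to its last neighbour on q and drop the part of q before that neighbour. -/
theorem exists_chordless_extension {w v : V} (q : G.Walk w v) (hp : q.IsPath)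
    (hc : q.IsChordless) {u : V} (hu : u ∉ q.support) (hx : ∃ x ∈ q.support, G.Adj u x) :
    ∃ r : G.Walk u v, r.IsPath ∧ r.IsChordless ∧ r.support ⊆ u :: q.support := by
  induction q with
  | nil =>
    obtain ⟨x, hx, hux⟩ := hx
    rw [support_nil, List.mem_singleton] at hx
    subst hx
    refine ⟨Walk.cons hux nil, hp.cons hu, hc.cons hux ?_, fun _ h => h⟩
    simp
  | @cons w w' v h q ih =>
    by_cases hq : ∃ x ∈ q.support, G.Adj u x
    · obtain ⟨r, h₁, h₂, h₃⟩ := ih hp.of_cons (IsChordless.of_cons hp hc)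
        (fun h' => hu (List.mem_cons_of_mem _ h')) hq
      refine ⟨r, h₁, h₂, fun y hy => ?_⟩
      have := h₃ hy
      rw [List.mem_cons] at this
      rcases this with rfl | h'
      · simp
      · simp [h']
    · push Not at hq
      have huw : G.Adj u w := by
        obtain ⟨x, hx, hux⟩ := hx
        rw [support_cons, List.mem_cons] at hx
        rcases hx with rfl | hx
        · exact hux
        · exact absurd hux (hq x hx)
      refine ⟨Walk.cons huw _, hp.cons hu, hc.cons huw ?_, fun _ h => h⟩
      intro x hx hux
      rw [support_cons, List.mem_cons] at hx
      rcases hx with rfl | hx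
      · rfl
      · exact absurd hux (hq x hx)

/-- Every walk can be shortened to a chordless path. -/
theorem exists_chordless_path {u v : V} (p : G.Walk u v) :
    ∃ q : G.Walk u v, q.IsPath ∧ q.IsChordless ∧ q.support ⊆ p.support := by
  induction p with
  | nil =>
    refine ⟨nil, IsPath.nil, ?_, fun _ h => h⟩
    rw [isChordless_iff_forall_mem_edges]
    intro x y hx hy hxy
    rw [support_nil, List.mem_singleton] at hx hy
    subst hx; subst hy
    exact absurd hxy (G.loopless.irrefl _)
  | @cons u w v h p ih =>
    obtain ⟨q, h₁, h₂, h₃⟩ := ih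
    by_cases hu : u ∈ q.support
    · obtain ⟨r, g₁, g₂, g₃⟩ := q.exists_chordless_suffix h₁ h₂ hu
      exact ⟨r, g₁, g₂, fun x hx => List.mem_cons_of_mem _ (h₃ (g₃ hx))⟩
    · obtain ⟨r, g₁, g₂, g₃⟩ := q.exists_chordless_extension h₁ h₂ hu ⟨w, q.start_mem_support, h⟩
      refine ⟨r, g₁, g₂, fun x hx => ?_⟩
      rw [support_cons]
      exact List.cons_subset_cons _ h₃ (g₃ hx)

end Walk

/-! ### Halfspaces as unions of shadows of edges -/

/-- The vertices reached from `a` within `r` steps by walks that avoid, after their start, the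
closed neighbourhood of `b`. If `a` and `b` are not adjacent, every vertex counts as reached. -/
def shadowLayer (G : SimpleGraph V) (a b : V) : ℕ → V → Prop
  | 0, _ => False
  | r + 1, j =>
    ¬ G.Adj a b ∨ j = a ∨ ∃ i, G.shadowLayer a b r i ∧ G.Adj i j ∧ ¬ G.Adj j b ∧ j ≠ b

theorem shadowLayer_succ {a b : V} {r : ℕ} {j : V} (h : G.shadowLayer a b r j) :
    G.shadowLayer a b (r + 1) j := by
  induction r generalizing j with
  | zero => exact h.elim
  | succ r ih =>
    rcases h with h | h | ⟨i, hi, h⟩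
    · exact Or.inl h
    · exact Or.inr (Or.inl h)
    · exact Or.inr (Or.inr ⟨i, ih hi, h⟩)

theorem shadowLayer_mono {a b : V} {r s : ℕ} (hrs : r ≤ s) {j : V} (h : G.shadowLayer a b r j) :
    G.shadowLayer a b s j := by
  induction hrs with
  | refl => exact h
  | step _ ih => exact shadowLayer_succ ih

theorem shadowLayer.exists_walk {a b : V} (hab : G.Adj a b) {r : ℕ} {z : V}
    (h : G.shadowLayer a b r z) :
    ∃ p : G.Walk a z, ∀ x ∈ p.support, x = a ∨ ¬ G.Adj x b ∧ x ≠ b := by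
  induction r generalizing z with
  | zero => exact h.elim
  | succ r ih =>
    rcases h with h | rfl | ⟨i, hi, hiz, hz⟩
    · exact absurd hab h
    · exact ⟨Walk.nil, by simp⟩
    · obtain ⟨p, hp⟩ := ih hi
      refine ⟨p.concat hiz, fun x hx => ?_⟩
      rw [Walk.support_concat, List.mem_append, List.mem_singleton] at hx
      rcases hx with hx | rfl
      · exact hp x hx
      · exact Or.inr hz

/-- If z were outside H, shortening the walk from a to z and prepending b would give a chordless
path between two vertices of the complement, since a is the only neighbour of b on it. But it passes
through a, which lies in H. -/
theorem IsMHalfspace.mem_of_shadowLayer {H : Set V} (hH : G.IsMHalfspace H) {a b z : V} {r : ℕ}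
    (hab : G.Adj a b) (ha : a ∈ H) (hb : b ∉ H) (h : G.shadowLayer a b r z) : z ∈ H := by
  by_contra hz
  obtain ⟨p, hp⟩ := h.exists_walk hab
  obtain ⟨q, h₁, h₂, h₃⟩ := p.exists_chordless_path
  have hbq : b ∉ q.support := fun hbq => by
    rcases hp b (h₃ hbq) with rfl | h'
    · exact hb ha
    · exact h'.2 rfl
  have hbz : b ≠ z := fun h' => hbq (h' ▸ q.end_mem_support)
  refine hH.2 b hb z hz ⟨hbz, Walk.cons hab.symm q, h₁.cons hbq, h₂.cons hab.symm ?_, ?_⟩ ha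
  · intro x hx hbx
    rcases hp x (h₃ hx) with rfl | h'
    · rfl
    · exact absurd hbx.symm h'.1
  · exact List.mem_cons_of_mem _ q.start_mem_support

/-- A convex set of a connected graph induces a connected subgraph. -/
theorem IsMConvex.exists_walk (hG : G.Connected) {X : Set V} (hX : G.IsMConvex X) {u v : V}
    (hu : u ∈ X) (hv : v ∈ X) : ∃ p : G.Walk u v, ∀ x ∈ p.support, x ∈ X := by
  obtain ⟨p⟩ := hG.preconnected u v
  obtain ⟨q, h₁, h₂, -⟩ := p.exists_chordless_path
  refine ⟨q, fun x hx => ?_⟩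
  -- The interval of equal endpoints is empty by definition, so convexity says nothing here.
  by_cases huv : u = v
  · subst huv
    have h₁ := (Walk.isPath_iff_nil.1 h₁).eq_nil
    subst h₁
    rw [Walk.support_nil, List.mem_singleton] at hx
    exact hx ▸ hu
  · exact hX u hu v hv ⟨huv, q, h₁, h₂, hx⟩

/-- The inner vertex boundary of a halfspace is a clique. -/
theorem IsMHalfspace.adj_of_boundary (hG : G.Connected) {H : Set V} (hH : G.IsMHalfspace H)
    {a₁ a₂ b₁ b₂ : V} (ha₁ : a₁ ∈ H) (ha₂ : a₂ ∈ H) (hb₁ : b₁ ∉ H) (hb₂ : b₂ ∉ H)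
    (h₁ : G.Adj a₁ b₁) (h₂ : G.Adj a₂ b₂) (hne : a₁ ≠ a₂) : G.Adj a₁ a₂ := by
  by_contra hadj
  obtain ⟨p, hp⟩ := hH.2.exists_walk hG hb₁ hb₂
  -- Go from a₁ to a₂ through the complement and shorten. The second vertex c lies in H by
  -- convexity, hence is not on p; c = a₁ is a loop and c = a₂ is the missing edge.
  obtain ⟨q, g₁, g₂, g₃⟩ := (Walk.cons h₁ (p.concat h₂.symm)).exists_chordless_path
  cases q with
  | nil => exact hne rfl
  | @cons _ c _ hc q =>
    have hcm : c ∈ (Walk.cons hc q).support := List.mem_cons_of_mem _ q.start_mem_support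
    have hcH : c ∈ H := hH.1 a₁ ha₁ a₂ ha₂ ⟨hne, _, g₁, g₂, hcm⟩
    have := g₃ hcm
    rw [Walk.support_cons, Walk.support_concat, List.mem_cons,
      List.mem_append, List.mem_singleton] at this
    rcases this with rfl | h | rfl
    · exact G.loopless.irrefl _ hc
    · exact hp c h hcH
    · exact hadj hc

/-- Take the first vertex a of the walk with a neighbour outside H. The vertices before it lie in H
and have no neighbour outside H, so they are neither equal nor adjacent to β a, and the walk read
backwards stays in the shadow. -/
theorem exists_shadowLayer_of_walk {H : Set V} {β : V → V}
    (hβ : ∀ a ∈ H, (∃ b, b ∉ H ∧ G.Adj a b) → β a ∉ H ∧ G.Adj a (β a)) {z y : V}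
    (p : G.Walk z y) (hz : z ∈ H) (hy : y ∉ H) :
    ∃ a, a ∈ H ∧ β a ∉ H ∧ G.Adj a (β a) ∧ G.shadowLayer a (β a) p.length z := by
  induction p with
  | nil => exact absurd hz hy
  | @cons z w y h p ih =>
    by_cases hb : ∃ b, b ∉ H ∧ G.Adj z b
    · exact ⟨z, hz, (hβ z hz hb).1, (hβ z hz hb).2, Or.inr (Or.inl rfl)⟩
    · push Not at hb
      have hw : w ∈ H := by
        by_contra hw
        exact hb w hw h
      obtain ⟨a, ha, h₁, h₂, h₃⟩ := ih hw hy
      refine ⟨a, ha, h₁, h₂, Or.inr (Or.inr ⟨w, h₃, h.symm, hb _ h₁, ?_⟩)⟩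
      rintro rfl
      exact h₁ hz

/-- Every halfspace is the union of at most `ω` shadows. -/
theorem IsMHalfspace.exists_shadow_cover [Fintype V] (hG : G.Connected) {H : Set V}
    (hH : G.IsMHalfspace H) :
    ∃ K : Finset (V × V), K.card ≤ G.cliqueNum ∧
      (∀ c ∈ K, ∀ r z, G.shadowLayer c.1 c.2 r z → z ∈ H) ∧
      ∀ z ∈ H, ∃ c ∈ K, G.shadowLayer c.1 c.2 (Fintype.card V) z := by
  classical
  obtain ⟨v₀⟩ := hG.nonempty
  have hpos : 0 < Fintype.card V := Fintype.card_pos_iff.2 ⟨v₀⟩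
  by_cases hfull : ∀ z, z ∈ H
  -- A loop is a non-edge, so the shadow of this pair is the whole vertex set.
  · refine ⟨{(v₀, v₀)}, ?_, fun c _ r z _ => hfull z, fun z _ => ?_⟩
    · have : G.IsClique (({v₀} : Finset V) : Set V) := by simp
      simpa using this.card_le_cliqueNum
    · refine ⟨(v₀, v₀), by simp, ?_⟩
      obtain ⟨m, hm⟩ := Nat.exists_eq_succ_of_ne_zero hpos.ne'
      rw [hm]
      exact Or.inl (G.loopless.irrefl _)
  · push Not at hfull
    obtain ⟨y, hy⟩ := hfull
    have hex : ∀ a, ∃ b, a ∈ H → (∃ b, b ∉ H ∧ G.Adj a b) → b ∉ H ∧ G.Adj a b := by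
      intro a
      by_cases h : ∃ b, b ∉ H ∧ G.Adj a b
      · obtain ⟨b, hb⟩ := h
        exact ⟨b, fun _ _ => hb⟩
      · exact ⟨a, fun _ h' => absurd h' h⟩
    choose β hβ using hex
    let B : Finset V := Finset.univ.filter fun a => a ∈ H ∧ β a ∉ H ∧ G.Adj a (β a)
    refine ⟨B.image fun a => (a, β a), ?_, ?_, ?_⟩
    · refine Finset.card_image_le.trans ?_
      refine IsClique.card_le_cliqueNum (G := G) (t := B) (tc := ?_)
      intro a₁ ha₁ a₂ ha₂ hne
      simp only [B, Finset.coe_filter, Finset.mem_univ, true_and, Set.mem_ofPred_eq] at ha₁ ha₂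
      exact hH.adj_of_boundary hG ha₁.1 ha₂.1 ha₁.2.1 ha₂.2.1 ha₁.2.2 ha₂.2.2 hne
    · intro c hc r z hz
      obtain ⟨a, ha, rfl⟩ := Finset.mem_image.1 hc
      simp only [B, Finset.mem_filter, Finset.mem_univ, true_and] at ha
      exact hH.mem_of_shadowLayer ha.2.2 ha.1 ha.2.1 hz
    · intro z hz
      obtain ⟨p, hp⟩ := hG.exists_isPath z y
      obtain ⟨a, h₁, h₂, h₃, h₄⟩ := exists_shadowLayer_of_walk hβ p hz hy
      refine ⟨(a, β a), Finset.mem_image.2 ⟨a, by simp [B, h₁, h₂, h₃], rfl⟩, ?_⟩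
      exact shadowLayer_mono hp.length_lt.le h₄

end SimpleGraph

/-! ### The Winnow algorithm with bounded weights -/

namespace Winnow

/-- The total weight of the active ones among the first `N` attributes, where attribute `k` has
weight `2 ^ e k`. -/
def activeWeight (N : ℕ) (e : ℕ → ℕ) (x : ℕ → Bool) : ℕ :=
  ∑ k ∈ Finset.range N, if x k then 2 ^ e k else 0

/-- The label predicted for an instance with active attributes `x`. -/
def prediction (N : ℕ) (e : ℕ → ℕ) (x : ℕ → Bool) : Bool :=
  decide (2 * N ≤ activeWeight N e x)

/-- The exponents after the true label `y` is revealed: on a mistake the weights of the active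
attributes are doubled, or halved unless they are `1`. -/
def step (N : ℕ) (e : ℕ → ℕ) (x : ℕ → Bool) (y : Bool) (k : ℕ) : ℕ :=
  if x k ∧ prediction N e x ≠ y then (if y then e k + 1 else e k - 1) else e k

variable {N : ℕ} {e : ℕ → ℕ} {x : ℕ → Bool} {y : Bool}

theorem step_of_eq (h : prediction N e x = y) : step N e x y = e := by
  funext k
  simp [step, h]

/-- Doubling happens only when the active weight is below 2N, so a doubled weight was itself below
2N. -/
theorem pow_step_le (he : ∀ k < N, 2 ^ e k ≤ 4 * N) : ∀ k < N, 2 ^ step N e x y k ≤ 4 * N := by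
  intro k hk
  have h := he k hk
  unfold step
  split_ifs with h₁ h₂
  · obtain ⟨hx, hp⟩ := h₁
    subst h₂
    have hs : activeWeight N e x < 2 * N := by
      simpa [prediction] using hp
    have : (if x k then 2 ^ e k else 0) ≤ activeWeight N e x :=
      Finset.single_le_sum (f := fun k => if x k then 2 ^ e k else 0) (fun _ _ => Nat.zero_le _)
        (Finset.mem_range.2 hk)
    rw [if_pos hx] at this
    rw [pow_succ]
    omega
  · exact (Nat.pow_le_pow_right (by norm_num) (Nat.sub_le _ _)).trans h
  · exact h

theorem sum_pow_promotion (hp : prediction N e x = false) :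
    ∑ k ∈ Finset.range N, 2 ^ step N e x true k
      = (∑ k ∈ Finset.range N, 2 ^ e k) + activeWeight N e x := by
  rw [activeWeight, ← Finset.sum_add_distrib]
  refine Finset.sum_congr rfl fun k _ => ?_
  cases hx : x k <;> simp [step, hx, hp, pow_succ, mul_two]

/-- Halving removes half of the active weight, except that each weight stuck at 1 keeps its 1/2;
there are at most N of these. -/
theorem sum_pow_demotion (hp : prediction N e x = true) :
    2 * (∑ k ∈ Finset.range N, 2 ^ step N e x false k) + activeWeight N e x
      ≤ 2 * (∑ k ∈ Finset.range N, 2 ^ e k) + N := by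
  suffices h : ∑ k ∈ Finset.range N, (2 * 2 ^ step N e x false k + if x k then 2 ^ e k else 0)
      ≤ ∑ k ∈ Finset.range N, (2 * 2 ^ e k + 1) by
    simpa only [activeWeight, Finset.sum_add_distrib, ← Finset.mul_sum, Finset.sum_const,
      Finset.card_range, smul_eq_mul, mul_one] using h
  refine Finset.sum_le_sum fun k _ => ?_
  cases hx : x k
  · simp [step, hx]
  · cases he : e k with
    | zero => simp [step, hx, hp, he]
    | succ m => simp [step, hx, hp, he, pow_succ]; omega

/-- One round decreases the potential, up to the price of an error of the disjunction `K`. -/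
theorem potential_step {K : Finset ℕ} :
    N * (if prediction N e x = y then 0 else 1)
        + 2 * (∑ k ∈ Finset.range N, 2 ^ step N e x y k) + 5 * N * ∑ k ∈ K, e k
      ≤ 2 * (∑ k ∈ Finset.range N, 2 ^ e k) + 5 * N * (∑ k ∈ K, step N e x y k)
        + 5 * N * (K.card + 1) * (if (decide (∃ k ∈ K, x k = true)) = y then 0 else 1) := by
  by_cases hm : prediction N e x = y
  · rw [step_of_eq hm, if_pos hm]
    simp
  rw [if_neg hm]
  -- A promotion raises 2W by less than 4N; if the disjunction is right, some exponent in K grows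
  -- and yields 5N. A demotion lowers 2W by at least N; exponents in K drop only if the disjunction
  -- errs, each by at most 1.
  cases y with
  | true =>
    have hp : prediction N e x = false := by simpa using hm
    have hs : activeWeight N e x < 2 * N := by simpa [prediction] using hp
    rw [sum_pow_promotion hp]
    have hmono : ∀ k, e k ≤ step N e x true k := by
      intro k; unfold step; split_ifs <;> simp_all
    by_cases hK : ∃ k ∈ K, x k = true
    · rw [if_pos (by simpa using hK)]
      have : ∑ k ∈ K, e k < ∑ k ∈ K, step N e x true k := by
        obtain ⟨k, hk, hx⟩ := hK
        refine Finset.sum_lt_sum (fun k _ => hmono k) ⟨k, hk, ?_⟩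
        simp [step, hx, hp]
      nlinarith
    · rw [if_neg (by simpa using hK)]
      have : ∑ k ∈ K, e k ≤ ∑ k ∈ K, step N e x true k := Finset.sum_le_sum fun k _ => hmono k
      have h' : 5 * N * ∑ k ∈ K, e k ≤ 5 * N * ∑ k ∈ K, step N e x true k :=
        Nat.mul_le_mul_left _ this
      nlinarith [Nat.zero_le (N * K.card)]
  | false =>
    have hp : prediction N e x = true := by simpa using hm
    have hs : 2 * N ≤ activeWeight N e x := by simpa [prediction] using hp
    have hW := sum_pow_demotion hp
    by_cases hK : ∃ k ∈ K, x k = true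
    · rw [if_neg (by simpa using hK)]
      have : ∑ k ∈ K, e k ≤ ∑ k ∈ K, step N e x false k + K.card := by
        rw [Finset.card_eq_sum_ones, ← Finset.sum_add_distrib]
        refine Finset.sum_le_sum fun k _ => ?_
        unfold step; split_ifs <;> omega
      have h' := Nat.mul_le_mul_left (5 * N) this
      nlinarith
    · rw [if_pos (by simpa using hK)]
      have : ∑ k ∈ K, step N e x false k = ∑ k ∈ K, e k := by
        refine Finset.sum_congr rfl fun k hk => ?_
        have : x k = false := by
          by_contra h
          exact hK ⟨k, hk, by simpa using h⟩
        simp [step, this]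
      rw [this]
      omega

/-- The logarithms of the weights of `K` are bounded. -/
theorem sum_exponents_le {K : Finset ℕ} (hK : ∀ k ∈ K, k < N) (he : ∀ k < N, 2 ^ e k ≤ 4 * N) :
    ∑ k ∈ K, e k ≤ K.card * Nat.log 2 (4 * N) := by
  rw [← smul_eq_mul]
  refine Finset.sum_le_card_nsmul _ _ _ fun k hk => ?_
  exact Nat.le_log_of_pow_le (by norm_num) (he k (hK k hk))

end Winnow

/-! ### Total correctness of programs within a time bound -/

namespace RAM

open RAM.Expr

instance : Add Expr := ⟨bin .add⟩
instance : Sub Expr := ⟨bin .sub⟩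
instance : Mul Expr := ⟨bin .mul⟩
instance : Div Expr := ⟨bin .div⟩

/-- The number of nodes of an expression. -/
def Expr.nodes : Expr → ℕ
  | const _ => 1
  | var _ => 1
  | read _ i => i.nodes + 1
  | bin _ e f => e.nodes + f.nodes + 1

/-- All values met in the evaluation of the expression are at most `M`. -/
def Expr.Fits (σ : State) (M : ℕ) : Expr → Prop
  | const k => k ≤ M
  | var x => σ.var x ≤ M
  | read a i => i.Fits σ M ∧ σ.arr a (i.eval σ) ≤ M
  | bin o e f => e.Fits σ M ∧ f.Fits σ M ∧ o.eval (e.eval σ) (f.eval σ) ≤ M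

section

variable {σ : State} {M k x a : ℕ} {e f i : Expr}

@[simp] theorem eval_const : (const k).eval σ = k := rfl
@[simp] theorem eval_var : (Expr.var x).eval σ = σ.var x := rfl
@[simp] theorem eval_read : (read a i).eval σ = σ.arr a (i.eval σ) := rfl
@[simp] theorem eval_add : (e + f).eval σ = e.eval σ + f.eval σ := rfl
@[simp] theorem eval_sub : (e - f).eval σ = e.eval σ - f.eval σ := rfl
@[simp] theorem eval_mul : (e * f).eval σ = e.eval σ * f.eval σ := rfl
@[simp] theorem eval_div : (e / f).eval σ = e.eval σ / f.eval σ := rfl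

@[simp] theorem nodes_const : (const k).nodes = 1 := rfl
@[simp] theorem nodes_var : (Expr.var x).nodes = 1 := rfl
@[simp] theorem nodes_read : (read a i).nodes = i.nodes + 1 := rfl
@[simp] theorem nodes_add : (e + f).nodes = e.nodes + f.nodes + 1 := rfl
@[simp] theorem nodes_sub : (e - f).nodes = e.nodes + f.nodes + 1 := rfl
@[simp] theorem nodes_mul : (e * f).nodes = e.nodes + f.nodes + 1 := rfl
@[simp] theorem nodes_div : (e / f).nodes = e.nodes + f.nodes + 1 := rfl

@[simp] theorem fits_const : (const k).Fits σ M ↔ k ≤ M := Iff.rfl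
@[simp] theorem fits_var : (Expr.var x).Fits σ M ↔ σ.var x ≤ M := Iff.rfl
@[simp] theorem fits_read :
    (read a i).Fits σ M ↔ i.Fits σ M ∧ σ.arr a (i.eval σ) ≤ M := Iff.rfl
@[simp] theorem fits_add :
    (e + f).Fits σ M ↔ e.Fits σ M ∧ f.Fits σ M ∧ e.eval σ + f.eval σ ≤ M := Iff.rfl
@[simp] theorem fits_mul :
    (e * f).Fits σ M ↔ e.Fits σ M ∧ f.Fits σ M ∧ e.eval σ * f.eval σ ≤ M := Iff.rfl

theorem Expr.Fits.eval_le (h : e.Fits σ M) : e.eval σ ≤ M := by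
  cases e with
  | const | var => exact h
  | read => exact h.2
  | bin => exact h.2.2

-- Truncated subtraction and integer division never exceed the left operand, so the result needs no
-- separate bound.
@[simp] theorem fits_sub : (e - f).Fits σ M ↔ e.Fits σ M ∧ f.Fits σ M :=
  ⟨fun h => ⟨h.1, h.2.1⟩, fun h => ⟨h.1, h.2, (Nat.sub_le _ _).trans h.1.eval_le⟩⟩

@[simp] theorem fits_div : (e / f).Fits σ M ↔ e.Fits σ M ∧ f.Fits σ M :=
  ⟨fun h => ⟨h.1, h.2.1⟩, fun h => ⟨h.1, h.2, (Nat.div_le_self _ _).trans h.1.eval_le⟩⟩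

theorem size_le_self (k : ℕ) : Nat.size k ≤ k := Nat.size_le.2 Nat.lt_two_pow_self

/-- Bounding bit lengths by the values themselves is crude, but enough for polynomial time. -/
theorem Expr.cost_le (h : e.Fits σ M) : e.cost σ ≤ e.nodes * (M + 1) := by
  induction e with
  | const k => have := size_le_self k; simp only [cost, nodes, fits_const] at *; omega
  | var x => have := size_le_self (σ.var x); simp only [cost, nodes, fits_var] at *; omega
  | read a i ih =>
    have h₁ := ih h.1
    have h₂ := size_le_self (σ.arr a (i.eval σ))
    have h₃ := h.2
    simp only [cost, nodes, add_mul]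
    omega
  | bin o e f ihe ihf =>
    have h₁ := ihe h.1
    have h₂ := ihf h.2.1
    have h₃ := h.2.2
    have h₄ := size_le_self (o.eval (e.eval σ) (f.eval σ))
    simp only [cost, nodes, add_mul]
    omega

end

/-- Started with memory `σ`, the program halts within time `B` with a memory satisfying `Q`. -/
def Runs (P : Prog) (σ : State) (B : ℕ) (Q : State → Prop) : Prop :=
  ∃ t σ', Exec P σ t σ' ∧ t ≤ B ∧ Q σ'

section

variable {σ : State} {M B B₁ B₂ : ℕ} {x a : ℕ} {e i lim : Expr} {P P₁ P₂ : Prog}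
  {Q Q₁ : State → Prop}

theorem Runs.mono (h : Runs P σ B₁ Q₁) (hB : B₁ ≤ B) (hQ : ∀ σ', Q₁ σ' → Q σ') :
    Runs P σ B Q := by
  obtain ⟨t, σ', h₁, h₂, h₃⟩ := h
  exact ⟨t, σ', h₁, h₂.trans hB, hQ _ h₃⟩

theorem Runs.skip (hQ : Q σ) : Runs .skip σ 1 Q := ⟨1, σ, .skip σ, le_rfl, hQ⟩

theorem Runs.assign (he : e.Fits σ M) (hQ : Q (σ.setVar x (e.eval σ))) :
    Runs (.assign x e) σ (e.nodes * (M + 1) + 1) Q :=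
  ⟨_, _, .assign x e σ, Nat.add_le_add_right (Expr.cost_le he) 1, hQ⟩

theorem Runs.write (hi : i.Fits σ M) (he : e.Fits σ M)
    (hQ : Q (σ.setArr a (i.eval σ) (e.eval σ))) :
    Runs (.write a i e) σ (i.nodes * (M + 1) + e.nodes * (M + 1) + 1) Q :=
  ⟨_, _, .write a i e σ,
    Nat.add_le_add_right (Nat.add_le_add (Expr.cost_le hi) (Expr.cost_le he)) 1, hQ⟩

theorem Runs.seq (h₁ : Runs P₁ σ B₁ Q₁) (h₂ : ∀ σ', Q₁ σ' → Runs P₂ σ' B₂ Q) :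
    Runs (.seq P₁ P₂) σ (B₁ + B₂) Q := by
  obtain ⟨t₁, σ₁, h, ht, hQ⟩ := h₁
  obtain ⟨t₂, σ₂, h', ht', hQ'⟩ := h₂ _ hQ
  exact ⟨_, _, .seq h h', Nat.add_le_add ht ht', hQ'⟩

theorem Runs.assign_seq (k : ℕ) (hk : e.eval σ = k) (he : e.Fits σ M)
    (h : Runs P (σ.setVar x k) B Q) :
    Runs (.seq (.assign x e) P) σ (e.nodes * (M + 1) + 1 + B) Q :=
  (Runs.assign (Q := fun σ' => σ' = σ.setVar x k) he (by rw [hk])).seq fun _ h' => h' ▸ h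

theorem Runs.cond (he : e.Fits σ M) (h₁ : e.eval σ ≠ 0 → Runs P₁ σ B Q)
    (h₂ : e.eval σ = 0 → Runs P₂ σ B Q) :
    Runs (.cond e P₁ P₂) σ (e.nodes * (M + 1) + 1 + B) Q := by
  have hc := Expr.cost_le he
  by_cases h : e.eval σ = 0
  · obtain ⟨t, σ', h₃, h₄, h₅⟩ := h₂ h
    exact ⟨_, σ', .cond_false h h₃, by omega, h₅⟩
  · obtain ⟨t, σ', h₃, h₄, h₅⟩ := h₁ h
    exact ⟨_, σ', .cond_true h h₃, by omega, h₅⟩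

/-- Run `P` with the values `0, 1, …` of the variable `x`, as long as `x` is below `lim`. -/
def forLoop (x : ℕ) (lim : Expr) (P : Prog) : Prog :=
  .seq (.assign x (const 0))
    (.loop (lim - .var x) (.seq P (.assign x (.var x + const 1))))

/-- The time of a loop of `N` rounds, each taking time `B` for its body. -/
def loopBound (N c B M : ℕ) : ℕ := N * (B + (c + 5) * (M + 1) + 2) + (c + 2) * (M + 1) + 3

theorem Runs.forLoop {N : ℕ} (I : ℕ → State → Prop) (hN : N ≤ M)
    (hI : ∀ i σ, I i σ → σ.var x = i ∧ lim.Fits σ M ∧ lim.eval σ = N)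
    (h0 : I 0 (σ.setVar x 0))
    (hP : ∀ i < N, ∀ σ, I i σ →
      Runs P σ B fun σ' => σ'.var x = i ∧ I (i + 1) (σ'.setVar x (i + 1))) :
    Runs (forLoop x lim P) σ (loopBound N lim.nodes B M) (I N) := by
  -- Induction on the number d of remaining rounds. Besides its body a round pays for the test
  -- (`lim.nodes + 2` nodes), the increment (3 nodes) and 1 for each of these two commands.
  have key : ∀ d i σ, i + d = N → I i σ →
      Runs (.loop (lim - .var x) (.seq P (.assign x (.var x + const 1)))) σ
        (d * (B + (lim.nodes + 5) * (M + 1) + 2) + (lim.nodes + 2) * (M + 1) + 1) (I N) := by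
    intro d
    induction d with
    | zero =>
      intro i σ hi h
      obtain ⟨h₁, h₂, h₃⟩ := hI i σ h
      have hfit : (lim - .var x).Fits σ M := by simp [h₂, h₁]; omega
      have hc := Expr.cost_le hfit
      refine ⟨_, σ, .loop_false (by simp [h₁, h₃]; omega), ?_, by rwa [← hi]⟩
      simp only [nodes_sub, nodes_var, add_mul, one_mul] at hc ⊢
      omega
    | succ d ih =>
      intro i σ hi h
      obtain ⟨h₁, h₂, h₃⟩ := hI i σ h
      have hfit : (lim - .var x).Fits σ M := by simp [h₂, h₁]; omega
      have hc := Expr.cost_le hfit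
      obtain ⟨t, σ', h₄, h₅, h₆, h₇⟩ := hP i (by omega) σ h
      have hfit' : (Expr.var x + const 1).Fits σ' M := by simp [h₆]; omega
      have hc' := Expr.cost_le hfit'
      have hev : (Expr.var x + const 1).eval σ' = i + 1 := by simp [h₆]
      obtain ⟨t', σ'', h₈, h₉, h₁₀⟩ := ih (i + 1) (σ'.setVar x (i + 1)) (by omega) h₇
      refine ⟨_, σ'', .loop_true (by simp [h₁, h₃]; omega)
        (.seq h₄ (.assign x _ σ')) (by rw [hev]; exact h₈), ?_, h₁₀⟩
      simp only [nodes_sub, nodes_add, nodes_var, nodes_const, add_mul, one_mul] at hc hc' h₉ ⊢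
      omega
  obtain ⟨t, σ', h₁, h₂, h₃⟩ := key N 0 _ (Nat.zero_add N) h0
  refine ⟨_, σ', .seq (.assign x (const 0) σ) h₁, ?_, h₃⟩
  simp only [Expr.cost, Nat.size_zero, loopBound]
  omega

end

/-! ### The programs -/

/-- One step in the computation of the table of shadows: variable `5` encodes four vertices
`a`, `b`, `i`, `j`, and the entry of `j` in the table of `(a, b)` may be set because of the entry
of `i`. -/
def shadowStep : Prog :=
  .seq (.assign 6 (.var 5 / .var 0)) <|
  .seq (.assign 7 (.var 6 / .var 0)) <|
  .seq (.assign 8 (.var 5 - .var 0 * .var 6)) <|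
  .seq (.assign 9 (.var 6 - .var 0 * .var 7)) <|
  .seq (.assign 10 (.var 7 / .var 0)) <|
  .seq (.assign 11 (.var 7 - .var 0 * .var 10)) <|
  .cond (const 1 - read 0 (.var 7)
      + (const 1 - (.var 8 - .var 10 + (.var 10 - .var 8)))
      + read 1 (.var 6) * read 0 (.var 9 * .var 0 + .var 8)
        * (const 1 - read 0 (.var 8 * .var 0 + .var 11))
        * (.var 8 - .var 11 + (.var 11 - .var 8)))
    (.write 1 (.var 7 * .var 0 + .var 8) (const 1)) .skip

/-- Compute the table of shadows in array `1`. -/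
def setupProg : Prog :=
  forLoop 4 (.var 0) (forLoop 5 (.var 0 * .var 0 * .var 0 * .var 0) shadowStep)

/-- Add up the weights of the attributes of the vertex in variable `1` and compare the sum with
the threshold. Array `2` holds the weights minus one. -/
def predictProg : Prog :=
  .seq (.assign 2 (const 0)) <|
  .seq (forLoop 4 (.var 0 * .var 0)
    (.assign 2 (.var 2 + read 1 (.var 4 * .var 0 + .var 1) * (read 2 (.var 4) + const 1)))) <|
  .assign 2 (.var 2 - (const 2 * (.var 0 * .var 0) - const 1))

/-- After a mistake, double or halve the weights of the active attributes. -/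
def updateProg : Prog :=
  forLoop 4 (.var 0 * .var 0)
    (.cond (read 1 (.var 4 * .var 0 + .var 1)
        * (.var 3 * (const 1 - .var 2) + (const 1 - .var 3) * .var 2))
      (.write 2 (.var 4) (.var 3 * (read 2 (.var 4) + read 2 (.var 4) + const 1)
        + (const 1 - .var 3) * (read 2 (.var 4) / const 2))) .skip)

/-- A bound for all numbers that occur in the computation. -/
def valueBound (n : ℕ) : ℕ := 4 * n ^ 4 + n ^ 3 + 4 * n ^ 2 + n + 5

@[simp] theorem setVar_var (σ : State) (x k y : ℕ) :
    (σ.setVar x k).var y = if y = x then k else σ.var y := by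
  simp [State.setVar, Function.update_apply]

@[simp] theorem setVar_arr (σ : State) (x k : ℕ) : (σ.setVar x k).arr = σ.arr := rfl

@[simp] theorem setArr_var (σ : State) (a i k : ℕ) : (σ.setArr a i k).var = σ.var := rfl

theorem setArr_arr (σ : State) (a i k b : ℕ) :
    (σ.setArr a i k).arr b = if b = a then Function.update (σ.arr a) i k else σ.arr b := by
  simp [State.setArr, Function.update_apply]

/-! ### Base n digits: coding tuples of vertices as numbers. -/

section Digits

variable {n : ℕ}

theorem digit_lt {m a b : ℕ} (ha : a < m) (hb : b < n) : a * n + b < m * n := by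
  calc a * n + b < a * n + n := by omega
    _ = (a + 1) * n := by ring
    _ ≤ m * n := Nat.mul_le_mul_right _ ha

theorem digit_div {a b : ℕ} (hb : b < n) : (a * n + b) / n = a := by
  rw [add_comm, Nat.add_mul_div_right _ _ (by omega), Nat.div_eq_of_lt hb, zero_add]

theorem digit_sub {a b : ℕ} : a * n + b - n * a = b := by
  rw [mul_comm]; omega

theorem digit_inj {a b a' b' : ℕ} (hb : b < n) (hb' : b' < n) :
    a * n + b = a' * n + b' ↔ a = a' ∧ b = b' := by
  refine ⟨fun h => ?_, by rintro ⟨rfl, rfl⟩; rfl⟩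
  have h₁ : a = a' := by rw [← digit_div (a := a) hb, h, digit_div hb']
  subst h₁
  omega

theorem exists_digit {m q : ℕ} (hq : q < m * n) : ∃ a < m, ∃ b : Fin n, q = a * n + b := by
  have hn : 0 < n := by
    rcases Nat.eq_zero_or_pos n with rfl | h
    · simp at hq
    · exact h
  exact ⟨q / n, Nat.div_lt_of_lt_mul (by rwa [mul_comm]), ⟨q % n, Nat.mod_lt _ hn⟩,
    by simpa [mul_comm] using (Nat.div_add_mod q n).symm⟩

end Digits

/-! ### Correctness and running time of the table of shadows. -/

section Setup

variable {n : ℕ} {G : SimpleGraph (Fin n)}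

open Classical in
theorem graphInput_arr (G : SimpleGraph (Fin n)) (i j : Fin n) :
    (graphInput G).arr 0 (i * n + j) = if G.Adj i j then 1 else 0 := by
  have : (∃ i' j' : Fin n, (i : ℕ) * n + j = i' * n + j' ∧ G.Adj i' j') ↔ G.Adj i j := by
    constructor
    · rintro ⟨i', j', h, h'⟩
      rw [digit_inj j.2 j'.2] at h
      rwa [Fin.ext h.1, Fin.ext h.2]
    · exact fun h => ⟨i, j, rfl, h⟩
  simp [graphInput, this]

/-- The condition under which a step sets an entry of the table `T`. -/
def StepCond (G : SimpleGraph (Fin n)) (T : ℕ → ℕ) (a b i j : Fin n) : Prop :=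
  ¬ G.Adj a b ∨ j = a ∨ T ((a * n + b) * n + i) ≠ 0 ∧ G.Adj i j ∧ ¬ G.Adj j b ∧ j ≠ b

theorem absDiff_eq_zero {i j : Fin n} : (i : ℕ) - j + (j - i) = 0 ↔ i = j := by
  rw [Fin.ext_iff]; omega

/-- Over ℕ a sum is nonzero iff some term is, a product iff all factors are, and 1 - d iff d = 0. -/
theorem test_ne_zero (p q r : Prop) [Decidable p] [Decidable q] [Decidable r] (t d d' : ℕ) :
    (1 - if p then 1 else 0) + (1 - d) + (t * if q then 1 else 0) * (1 - if r then 1 else 0) * d'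
      ≠ 0 ↔ ¬ p ∨ d = 0 ∨ t ≠ 0 ∧ q ∧ ¬ r ∧ d' ≠ 0 := by
  by_cases p <;> by_cases q <;> by_cases r <;> simp [*] <;> omega

open Classical in
theorem runs_shadowStep {σ : State} (a b i j : Fin n) (h0 : σ.var 0 = n)
    (h5 : σ.var 5 = ((a * n + b) * n + i) * n + j) (hA : σ.arr 0 = (graphInput G).arr 0)
    (hT : ∀ k, σ.arr 1 k ≤ 1) :
    Runs shadowStep σ (100 * (valueBound n + 1) + 20) fun σ' =>
      σ'.var 0 = n ∧ σ'.var 4 = σ.var 4 ∧ σ'.var 5 = σ.var 5 ∧ σ'.arr 0 = σ.arr 0 ∧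
      σ'.arr 2 = σ.arr 2 ∧ σ'.arr 1 = if StepCond G (σ.arr 1) a b i j
        then Function.update (σ.arr 1) ((a * n + b) * n + j) 1 else σ.arr 1 := by
  have ha := a.2
  have hb := b.2
  have hi := i.2
  have hj := j.2
  have hab : (a * n + b : ℕ) < n * n := digit_lt ha hb
  have habi : ((a * n + b) * n + i : ℕ) < n * n * n := digit_lt hab hi
  have habj : ((a * n + b) * n + j : ℕ) < n * n * n := digit_lt hab hj
  have hq : (((a * n + b) * n + i) * n + j : ℕ) < n * n * n * n := digit_lt habi hj
  have hij : (i * n + j : ℕ) < n * n := digit_lt hi hj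
  have hjb : (j * n + b : ℕ) < n * n := digit_lt hj hb
  have hM : valueBound n = 4 * (n * n * n * n) + n * n * n + 4 * (n * n) + n + 5 := by
    unfold valueBound; ring
  -- The remainders are computed as q - n * (q / n); these bounds keep the products in range.
  have hm₁ : n * ((a * n + b) * n + i) ≤ ((a * n + b) * n + i) * n + j := by
    rw [mul_comm]; omega
  have hm₂ : n * (a * n + b) ≤ (a * n + b) * n + i := by rw [mul_comm]; omega
  have hm₃ : n * a ≤ a * n + b := by rw [mul_comm]; omega
  have hA₁ := graphInput_arr G a b
  have hA₂ := graphInput_arr G i j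
  have hA₃ := graphInput_arr G j b
  have hT₁ := hT ((a * n + b) * n + i)
  have hiff : ¬((1 - if G.Adj a b then 1 else 0) + (1 - ((j : ℕ) - a + (a - j)))
      + (σ.arr 1 ((a * n + b) * n + i) * if G.Adj i j then 1 else 0)
        * (1 - if G.Adj j b then 1 else 0) * ((j : ℕ) - b + (b - j)) = 0)
      ↔ StepCond G (σ.arr 1) a b i j := by
    rw [← Ne, test_ne_zero, StepCond, absDiff_eq_zero, Ne, Ne, absDiff_eq_zero]
  have hM₄ : n * n * n * n ≤ valueBound n := by omega
  refine Runs.mono (Runs.assign_seq (M := valueBound n) ((a * n + b) * n + i)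
    (by simp [h0, h5, digit_div hj]) (by simp [h0, h5]; omega)
    (Runs.assign_seq (M := valueBound n) (a * n + b)
    (by simp [h0, digit_div hi]) (by simp [h0]; omega)
    (Runs.assign_seq (M := valueBound n) j
    (by simp [h0, h5, digit_sub]) (by simp [h0, h5]; omega)
    (Runs.assign_seq (M := valueBound n) i
    (by simp [h0, digit_sub]) (by simp [h0]; omega)
    (Runs.assign_seq (M := valueBound n) a
    (by simp [h0, digit_div hb]) (by simp [h0]; omega)
    (Runs.assign_seq (M := valueBound n) b
    (by simp [h0, digit_sub]) (by simp [h0]; omega)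
    (Runs.cond (M := valueBound n) (B := 10 * (valueBound n + 1) + 1) ?_ ?_ ?_)))))))
    (B₁ := _) ?_ fun _ h => h
  · have hbool : ∀ (p : Prop) [Decidable p], (if p then 1 else 0) ≤ 1 := by
      intro p _; split_ifs <;> simp
    have hb₁ := hbool (G.Adj a b)
    have hb₂ := hbool (G.Adj i j)
    have hb₃ := hbool (G.Adj j b)
    have hp₁ := Nat.mul_le_mul hT₁ hb₂
    have hp₂ := Nat.mul_le_mul hp₁ (Nat.sub_le 1 (if G.Adj j b then 1 else 0))
    have hd : (j : ℕ) - b + (b - j) ≤ n := by omega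
    have hp₃ := Nat.mul_le_mul hp₂ hd
    simp only [fits_add, fits_sub, fits_mul, fits_read, fits_const, fits_var, eval_add, eval_sub,
      eval_mul, eval_read, eval_const, eval_var, setVar_var, setVar_arr, h0, hA, hA₁, hA₂, hA₃,
      reduceIte, Nat.reduceEqDiff]
    omega
  · intro h
    have hs : StepCond G (σ.arr 1) a b i j := by
      rw [← hiff, ← hA₁, ← hA₂, ← hA₃]
      simpa only [eval_add, eval_sub, eval_mul, eval_read, eval_const, eval_var, setVar_var,
        setVar_arr, h0, hA, reduceIte, Nat.reduceEqDiff] using h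
    refine Runs.mono (Runs.write (M := valueBound n) ?_ ?_ ?_) (by simp; omega) fun _ h => h
    · simp [h0]; omega
    · simp; omega
    · simp [h0, setArr_arr, hs]
  · intro h
    have hs : ¬ StepCond G (σ.arr 1) a b i j := by
      rw [← hiff, ← hA₁, ← hA₂, ← hA₃, not_not]
      simpa only [eval_add, eval_sub, eval_mul, eval_read, eval_const, eval_var, setVar_var,
        setVar_arr, h0, hA, reduceIte, Nat.reduceEqDiff] using h
    refine Runs.mono (Runs.skip ?_) (by omega) fun _ h => h
    simp [h0, hs]
  · simp
    omega

/-- The memory while the table of shadows is computed: all marked vertices belong to the shadows,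
and the vertices reached within `r` steps are marked. -/
structure TableInv (G : SimpleGraph (Fin n)) (r : ℕ) (σ : State) : Prop where
  size : σ.var 0 = n
  adj : σ.arr 0 = (graphInput G).arr 0
  weights : ∀ k, σ.arr 2 k = 0
  le_one : ∀ k, σ.arr 1 k ≤ 1
  sound : ∀ a b z : Fin n, σ.arr 1 ((a * n + b) * n + z) ≠ 0 → ∃ s, G.shadowLayer a b s z
  complete : ∀ a b z : Fin n, G.shadowLayer a b r z → σ.arr 1 ((a * n + b) * n + z) ≠ 0

theorem TableInv.setVar {r : ℕ} {σ : State} (h : TableInv G r σ) {x : ℕ} (hx : x ≠ 0) (k : ℕ) :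
    TableInv G r (σ.setVar x k) :=
  ⟨by simp [hx.symm, h.size], h.adj, h.weights, h.le_one, h.sound, h.complete⟩

theorem TableInv.update {r : ℕ} {σ σ' : State} (h : TableInv G r σ) (h0 : σ'.var 0 = n)
    (hA : σ'.arr 0 = σ.arr 0) (hU : σ'.arr 2 = σ.arr 2) {a b i j : Fin n}
    (hc : StepCond G (σ.arr 1) a b i j)
    (hT : σ'.arr 1 = Function.update (σ.arr 1) ((a * n + b) * n + j) 1) : TableInv G r σ' := by
  refine ⟨h0, hA.trans h.adj, fun k => hU ▸ h.weights k, fun k => ?_, fun a' b' z hz => ?_,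
    fun a' b' z hz => ?_⟩
  · rw [hT, Function.update_apply]
    split_ifs
    · exact le_rfl
    · exact h.le_one k
  · rw [hT, Function.update_apply] at hz
    split_ifs at hz with heq
    · rw [digit_inj z.2 j.2, digit_inj b'.2 b.2] at heq
      obtain ⟨⟨ha, hb⟩, hj⟩ := heq
      rw [Fin.ext ha, Fin.ext hb, Fin.ext hj]
      rcases hc with hc | hc | ⟨hi, hc⟩
      · exact ⟨1, Or.inl hc⟩
      · exact ⟨1, Or.inr (Or.inl hc)⟩
      · obtain ⟨s, hs⟩ := h.sound a b i hi
        exact ⟨s + 1, Or.inr (Or.inr ⟨i, hs, hc⟩)⟩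
    · exact h.sound a' b' z hz
  · rw [hT, Function.update_apply]
    split_ifs
    · exact one_ne_zero
    · exact h.complete a' b' z hz

/-- The time of the body of the outer loop of `setupProg`. -/
def sweepTime (n : ℕ) : ℕ :=
  loopBound (n * n * n * n) 7 (100 * (valueBound n + 1) + 20) (valueBound n)

/-- The time of `setupProg`. -/
def setupTime (n : ℕ) : ℕ := loopBound n 1 (sweepTime n) (valueBound n)

theorem le_valueBound : n ≤ valueBound n ∧ n * n ≤ valueBound n ∧ n * n * n ≤ valueBound n ∧
    n * n * n * n ≤ valueBound n := by
  have hM : valueBound n = 4 * (n * n * n * n) + n * n * n + 4 * (n * n) + n + 5 := by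
    unfold valueBound; ring
  omega

/-- Marks are written in place, so a sweep may run ahead of layer r + 1. Hence soundness asks for
some layer only, and completeness rests on marks never being erased. -/
theorem runs_sweep {σ : State} {r : ℕ} (h : TableInv G r σ) (h4 : σ.var 4 = r) :
    Runs (forLoop 5 (.var 0 * .var 0 * .var 0 * .var 0) shadowStep) σ (sweepTime n)
      fun σ' => σ'.var 4 = r ∧ TableInv G (r + 1) σ' := by
  obtain ⟨hM₁, hM₂, hM₃, hM₄⟩ := le_valueBound (n := n)
  refine Runs.mono (Runs.forLoop (N := n * n * n * n) (M := valueBound n)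
    (B := 100 * (valueBound n + 1) + 20)
    (fun q σ' => σ'.var 5 = q ∧ σ'.var 4 = r ∧ TableInv G r σ' ∧
      ∀ a b i j : Fin n, ((a * n + b) * n + i) * n + j < q →
        (¬ G.Adj a b ∨ j = a ∨ G.shadowLayer a b r i ∧ G.Adj i j ∧ ¬ G.Adj j b ∧ j ≠ b) →
        σ'.arr 1 ((a * n + b) * n + j) ≠ 0) hM₄ ?_ ?_ ?_) le_rfl ?_
  · rintro q σ' ⟨h₁, -, h₂, -⟩
    simp [h₁, h₂.size]
    omega
  · refine ⟨by simp, by simp [h4], h.setVar (by norm_num) _, fun _ _ _ _ h => ?_⟩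
    exact absurd h (Nat.not_lt_zero _)
  · rintro q hq σ' ⟨h₁, h₂, h₃, h₄⟩
    obtain ⟨m, hm, j, rfl⟩ := exists_digit hq
    obtain ⟨m, hm', i, rfl⟩ := exists_digit hm
    obtain ⟨m, hm'', b, rfl⟩ := exists_digit hm'
    obtain ⟨a, rfl⟩ : ∃ a : Fin n, (a : ℕ) = m := ⟨⟨m, hm''⟩, rfl⟩
    refine (runs_shadowStep a b i j h₃.size h₁ h₃.adj h₃.le_one).mono le_rfl ?_
    rintro τ ⟨g0, g4, g5, gA, gU, gT⟩
    refine ⟨g5.trans h₁, by simp, by simp [g4, h₂], TableInv.setVar ?_ (by norm_num) _, ?_⟩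
    · by_cases hc : StepCond G (σ'.arr 1) a b i j
      · rw [if_pos hc] at gT
        exact h₃.update g0 gA gU hc gT
      · rw [if_neg hc] at gT
        exact ⟨g0, gA.trans h₃.adj, fun k => gU ▸ h₃.weights k, gT ▸ h₃.le_one, gT ▸ h₃.sound,
          gT ▸ h₃.complete⟩
    · intro a' b' i' j' hlt hc
      rw [setVar_arr, gT]
      rcases Nat.lt_succ_iff_lt_or_eq.1 hlt with hlt | heq
      · have := h₄ a' b' i' j' hlt hc
        split_ifs
        · rw [Function.update_apply]
          split_ifs
          · exact one_ne_zero
          · exact this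
        · exact this
      · rw [digit_inj j'.2 j.2, digit_inj i'.2 i.2, digit_inj b'.2 b.2, ← Fin.ext_iff,
          ← Fin.ext_iff, ← Fin.ext_iff, ← Fin.ext_iff] at heq
        obtain ⟨⟨⟨rfl, rfl⟩, rfl⟩, rfl⟩ := heq
        have : StepCond G (σ'.arr 1) a' b' i' j' := by
          rcases hc with hc | hc | ⟨hi, hc⟩
          · exact Or.inl hc
          · exact Or.inr (Or.inl hc)
          · exact Or.inr (Or.inr ⟨h₃.complete _ _ _ hi, hc⟩)
        rw [if_pos this, Function.update_self]
        exact one_ne_zero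
  · rintro σ' ⟨-, h₁, h₂, h₃⟩
    refine ⟨h₁, h₂.size, h₂.adj, h₂.weights, h₂.le_one, h₂.sound, fun a b z hz => ?_⟩
    have hlt : ∀ i : Fin n, (((a : ℕ) * n + b) * n + i) * n + z < n * n * n * n := fun i =>
      digit_lt (digit_lt (digit_lt a.2 b.2) i.2) z.2
    rcases hz with hz | hz | ⟨i, hi, hz⟩
    -- This alternative does not involve the intermediate vertex; z is an arbitrary choice for it.
    · exact h₃ a b z z (hlt z) (Or.inl hz)
    · exact h₃ a b z z (hlt z) (Or.inr (Or.inl hz))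
    · exact h₃ a b i z (hlt i) (Or.inr (Or.inr ⟨hi, hz⟩))

/-- Layer n suffices, because `IsMHalfspace.exists_shadow_cover` uses only the layer `Fintype.card
V`. -/
theorem runs_setupProg (G : SimpleGraph (Fin n)) :
    Runs setupProg (graphInput G) (setupTime n) (TableInv G n) := by
  obtain ⟨hM₁, -⟩ := le_valueBound (n := n)
  refine Runs.mono (Runs.forLoop (N := n) (M := valueBound n) (B := sweepTime n)
    (fun r σ => σ.var 4 = r ∧ TableInv G r σ) hM₁ ?_ ?_ ?_) le_rfl fun _ h => h.2
  · rintro r σ ⟨h₁, h₂⟩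
    simp [h₁, h₂.size, hM₁]
  · have h1 : ∀ k, (graphInput G).arr 1 k = 0 := fun k => by simp [graphInput]
    have h0 : TableInv G 0 (graphInput G) :=
      ⟨by simp [graphInput], rfl, fun k => by simp [graphInput], fun k => by simp [h1],
        fun a b z hz => absurd (h1 _) hz, fun a b z hz => False.elim hz⟩
    exact ⟨by simp, h0.setVar (by norm_num) _⟩
  · rintro r - σ ⟨h₁, h₂⟩
    refine (runs_sweep h₂ h₁).mono le_rfl ?_
    rintro σ' ⟨g₁, g₂⟩
    exact ⟨g₁, by simp, g₂.setVar (by norm_num) _⟩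

end Setup

/-! ### Correctness and running time of a round. -/

section Rounds

variable {n : ℕ} {T e : ℕ → ℕ}

/-- The attributes of the vertex `v` according to the table `T`. -/
def attributes (n : ℕ) (T : ℕ → ℕ) (v k : ℕ) : Bool := decide (T (k * n + v) ≠ 0)

/-- The memory between the rounds: the table `T` and the weights with exponents `e`. -/
structure RoundInv (n : ℕ) (T e : ℕ → ℕ) (σ : State) : Prop where
  size : σ.var 0 = n
  table : σ.arr 1 = T
  weights : ∀ k < n * n, σ.arr 2 k + 1 = 2 ^ e k

theorem RoundInv.setVar {σ : State} (h : RoundInv n T e σ) {x : ℕ} (hx : x ≠ 0) (k : ℕ) :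
    RoundInv n T e (σ.setVar x k) :=
  ⟨by simp [hx.symm, h.size], h.table, h.weights⟩

/-- For N = n² this is 4n⁴, the leading term of `valueBound`. -/
theorem activeWeight_le {N : ℕ} {x : ℕ → Bool} (he : ∀ k < N, 2 ^ e k ≤ 4 * N) {q : ℕ}
    (hq : q ≤ N) : Winnow.activeWeight q e x ≤ 4 * (N * N) := by
  have : Winnow.activeWeight q e x ≤ ∑ k ∈ Finset.range q, 4 * N := by
    refine Finset.sum_le_sum fun k hk => ?_
    split_ifs
    · exact he k ((Finset.mem_range.1 hk).trans_le hq)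
    · exact Nat.zero_le _
  rw [Finset.sum_const, Finset.card_range, smul_eq_mul] at this
  calc _ ≤ q * (4 * N) := this
    _ ≤ N * (4 * N) := Nat.mul_le_mul_right _ hq
    _ = _ := by ring

/-- The time of `predictProg`. -/
def predictTime (n : ℕ) : ℕ :=
  2 * (valueBound n + 1)
    + loopBound (n * n) 3 (20 * (valueBound n + 1)) (valueBound n)
    + 20 * (valueBound n + 1)

theorem valueBound_eq :
    valueBound n = 4 * (n * n * (n * n)) + n * n * n + 4 * (n * n) + n + 5 := by
  unfold valueBound; ring

/-- The output is the truncated difference W - (2N - 1) for the active weight W, which is nonzero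
iff 2N ≤ W; n > 0 makes 2N - 1 a genuine predecessor. -/
theorem runs_predictProg {σ : State} (hn : 0 < n) (h : RoundInv n T e σ) (hT : ∀ k, T k ≤ 1)
    (he : ∀ k < n * n, 2 ^ e k ≤ 4 * (n * n)) (v : Fin n) (hv : σ.var 1 = v) :
    Runs predictProg σ (predictTime n) fun σ' => RoundInv n T e σ' ∧ σ'.var 1 = v ∧
      σ'.var 2 ≤ valueBound n ∧
      decide (σ'.var 2 ≠ 0) = Winnow.prediction (n * n) e (attributes n T v) := by
  have hM := valueBound_eq (n := n)
  have hnn : 0 < n * n := Nat.mul_pos hn hn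
  refine Runs.mono (Runs.assign_seq (M := valueBound n) 0 rfl (by simp)
    (Runs.seq (Runs.forLoop (N := n * n) (M := valueBound n) (B := 20 * (valueBound n + 1))
      (fun q τ => τ.var 4 = q ∧ RoundInv n T e τ ∧ τ.var 1 = v ∧
        τ.var 2 = Winnow.activeWeight q e (attributes n T v)) (by omega) ?_ ?_ ?_)
    (B₂ := 10 * (valueBound n + 1) + 1) fun τ hτ => ?_)) (B₁ := _) ?_ fun _ h => h
  · rintro q τ ⟨h₁, h₂, -, -⟩
    simp [h₁, h₂.size]
    omega
  · exact ⟨by simp, (h.setVar (by norm_num) _).setVar (by norm_num) _, by simp [hv],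
      by simp [Winnow.activeWeight]⟩
  · rintro q hq τ ⟨h₁, h₂, h₃, h₄⟩
    have hlt : q * n + v < n * n * n := digit_lt hq v.2
    have hw := h₂.weights q hq
    have hle := he q hq
    have hT₁ := hT (q * n + v)
    have hA : Winnow.activeWeight (q + 1) e (attributes n T v)
        = Winnow.activeWeight q e (attributes n T v) + T (q * n + v) * (τ.arr 2 q + 1) := by
      rw [Winnow.activeWeight, Finset.sum_range_succ, hw]
      rcases Nat.le_one_iff_eq_zero_or_eq_one.1 hT₁ with h | h <;>
        simp [attributes, h, Winnow.activeWeight]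
    have hA₁ := activeWeight_le (x := attributes n T v) he (Nat.succ_le_of_lt hq)
    have hmul : T (q * n + v) * (τ.arr 2 q + 1) ≤ 1 * (4 * (n * n)) :=
      Nat.mul_le_mul hT₁ (hw ▸ hle)
    rw [hA] at hA₁
    refine Runs.mono (Runs.assign (M := valueBound n) ?_ ?_) ?_ fun _ h => h
    · simp only [fits_add, fits_mul, fits_read, fits_var, fits_const, eval_add, eval_mul,
        eval_read, eval_var, eval_const, h₁, h₂.size, h₂.table, h₃, h₄]
      omega
    · refine ⟨by simp [h₁], by simp, (h₂.setVar (by norm_num) _).setVar (by norm_num) _,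
        by simp [h₃], ?_⟩
      simp [h₁, h₂.size, h₂.table, h₃, h₄, hA]
    · simp
  · obtain ⟨h₁, h₂, h₃, h₄⟩ := hτ
    have hA := activeWeight_le (x := attributes n T v) he le_rfl
    refine Runs.mono (Runs.assign (M := valueBound n) ?_ ?_) ?_ fun _ h => h
    · simp only [fits_sub, fits_mul, fits_var, fits_const, eval_mul, eval_var, eval_const, h₄,
        h₂.size]
      omega
    · refine ⟨h₂.setVar (by norm_num) _, by simp [h₃], ?_, ?_⟩
      · simp only [setVar_var, reduceIte, eval_sub, eval_mul, eval_var, eval_const, h₄, h₂.size]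
        omega
      · simp only [setVar_var, reduceIte, eval_sub, eval_mul, eval_var, eval_const, h₄, h₂.size,
          Winnow.prediction, decide_eq_decide]
        omega
    · simp
  · simp [predictTime]
    omega

/-- The time of `updateProg`. -/
def updateTime (n : ℕ) : ℕ :=
  loopBound (n * n) 3 (60 * (valueBound n + 1)) (valueBound n)

/-- With weights stored minus one, halving becomes integer division by 2, which sends 2 ^ (m + 1) -
1 to 2 ^ m - 1 and fixes 0, so the floor at weight 1 needs no test. -/
theorem runs_updateProg {σ : State} (h : RoundInv n T e σ) (hT : ∀ k, T k ≤ 1)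
    (he : ∀ k < n * n, 2 ^ e k ≤ 4 * (n * n)) (v : Fin n) (hv : σ.var 1 = v) (y : Bool)
    (hy : σ.var 3 = y.toNat) (h2 : σ.var 2 ≤ valueBound n)
    (hp : decide (σ.var 2 ≠ 0) = Winnow.prediction (n * n) e (attributes n T v)) :
    Runs updateProg σ (updateTime n)
      (RoundInv n T (Winnow.step (n * n) e (attributes n T v) y)) := by
  have hM := valueBound_eq (n := n)
  set e' := Winnow.step (n * n) e (attributes n T v) y with he'
  -- The weights with index below q are already new. The prediction refers to the old ones, so it is
  -- kept in variable 2 throughout.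
  refine Runs.mono (Runs.forLoop (N := n * n) (M := valueBound n) (B := 60 * (valueBound n + 1))
    (fun q τ => τ.var 4 = q ∧ RoundInv n T (fun k => if k < q then e' k else e k) τ ∧
      τ.var 1 = v ∧ τ.var 2 = σ.var 2 ∧ τ.var 3 = y.toNat) (by omega) ?_ ?_ ?_) le_rfl ?_
  · rintro q τ ⟨h₁, h₂, -⟩
    simp [h₁, h₂.size]
    omega
  · refine ⟨by simp, ?_, by simp [hv], by simp, by simp [hy]⟩
    simpa using h.setVar (x := 4) (by norm_num) 0
  · rintro q hq τ ⟨h₁, h₂, h₃, h₄, h₅⟩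
    have hlt : q * n + v < n * n * n := digit_lt hq v.2
    have hw : τ.arr 2 q + 1 = 2 ^ e q := by simpa using h₂.weights q hq
    have hle := he q hq
    have hy₁ : y.toNat ≤ 1 := Bool.toNat_le y
    have hT₁ := hT (q * n + v)
    have hother : ∀ k ≠ q, (if k < q + 1 then e' k else e k) = if k < q then e' k else e k := by
      intro k hk
      have : k < q + 1 ↔ k < q := by omega
      simp [this]
    refine Runs.mono (Runs.cond (M := valueBound n) (B := 35 * (valueBound n + 1) + 1) ?_ ?_ ?_)
      (B₁ := _) ?_ fun _ h => h
    · have hb₁ : y.toNat * (1 - σ.var 2) ≤ 1 * 1 := Nat.mul_le_mul hy₁ (Nat.sub_le _ _)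
      have hb₂ : y.toNat * (1 - σ.var 2) + (1 - y.toNat) * σ.var 2 ≤ valueBound n := by
        cases y
        · simpa using h2
        · simp; omega
      have hb₃ := Nat.mul_le_mul hT₁ hb₂
      have hb₄ := Nat.mul_le_mul (Nat.sub_le 1 y.toNat) h2
      simp only [fits_add, fits_sub, fits_mul, fits_read, fits_var, fits_const, eval_add, eval_sub,
        eval_mul, eval_read, eval_var, eval_const, h₁, h₂.size, h₂.table, h₃, h₄, h₅]
      omega
    · intro htest
      have hact : attributes n T v q = true ∧
          Winnow.prediction (n * n) e (attributes n T v) ≠ y := by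
        simp only [eval_add, eval_sub, eval_mul, eval_read, eval_var, eval_const, h₁, h₂.size,
          h₂.table, h₃, h₄, h₅] at htest
        refine ⟨?_, ?_⟩
        · simp only [attributes, decide_eq_true_eq]
          exact left_ne_zero_of_mul htest
        · have := right_ne_zero_of_mul htest
          rw [← hp]
          cases y <;> simp at this ⊢ <;> omega
      have hval : y.toNat * (τ.arr 2 q + τ.arr 2 q + 1) + (1 - y.toNat) * (τ.arr 2 q / 2) + 1
          = 2 ^ e' q := by
        rw [he', Winnow.step, if_pos hact]
        cases y
        · cases heq : e q with
          | zero => rw [heq, pow_zero] at hw; simp; omega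
          | succ m => rw [heq, pow_succ] at hw; simp; omega
        · simp only [reduceIte, pow_succ, ← hw]; simp; omega
      refine Runs.mono (Runs.write (M := valueBound n) ?_ ?_ ?_) (B₁ := _) ?_ fun _ h => h
      · simp [h₁]; omega
      · have hnn := Nat.le_mul_self (n * n)
        have hdiv := Nat.div_le_self (τ.arr 2 q) 2
        have hc₁ := Nat.mul_le_mul hy₁ (le_refl (τ.arr 2 q + τ.arr 2 q + 1))
        have hc₂ := Nat.mul_le_mul (Nat.sub_le 1 y.toNat) (le_refl (τ.arr 2 q / 2))
        have hc₃ : y.toNat * (τ.arr 2 q + τ.arr 2 q + 1) + (1 - y.toNat) * (τ.arr 2 q / 2)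
            ≤ valueBound n := by
          cases y <;> simp <;> omega
        simp only [fits_add, fits_sub, fits_mul, fits_div, fits_read, fits_var, fits_const,
          eval_add, eval_sub, eval_mul, eval_div, eval_read, eval_var, eval_const, h₁, h₅]
        omega
      · refine ⟨by simp [h₁], by simp, ⟨by simp [h₂.size], ?_, ?_⟩, by simp [h₃], by simp [h₄],
          by simp [h₅]⟩
        · simp [setArr_arr, h₂.table]
        · intro k hk
          simp only [setVar_arr, setArr_arr, reduceIte, Function.update_apply, eval_add, eval_sub,
            eval_mul, eval_div, eval_read, eval_var, eval_const, h₁, h₅]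
          by_cases hkq : k = q
          · rw [if_pos hkq, hval, hkq, if_pos (Nat.lt_succ_self q)]
          · rw [if_neg hkq, hother k hkq]
            exact h₂.weights k hk
      · simp; omega
    · intro htest
      have hstep : e' q = e q := by
        simp only [eval_add, eval_sub, eval_mul, eval_read, eval_var, eval_const, h₁, h₂.size,
          h₂.table, h₃, h₄, h₅, mul_eq_zero] at htest
        rw [he', Winnow.step, if_neg]
        rintro ⟨hx, hne⟩
        rcases htest with htest | htest
        · simp [attributes, htest] at hx
        · rw [← hp] at hne
          cases y <;> simp at htest hne <;> omega
      refine Runs.mono (Runs.skip ?_) (by omega) fun _ h => h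
      refine ⟨h₁, by simp, ⟨by simp [h₂.size], h₂.table, ?_⟩, by simp [h₃], by simp [h₄],
        by simp [h₅]⟩
      intro k hk
      have := h₂.weights k hk
      by_cases hkq : k = q
      · subst hkq
        simpa [hstep] using this
      · rw [setVar_arr, hother k hkq]
        exact this
    · simp; omega
  · rintro τ ⟨-, h₁, -⟩
    exact ⟨h₁.size, h₁.table, fun k hk => by simpa [hk] using h₁.weights k hk⟩

end Rounds

end RAM

open RAM

/-! ### The algorithm and its mistake bound -/

/-- The bounded Winnow algorithm on the shadows of the graph. -/
def winnowAlgorithm : OnlineAlgorithm := ⟨setupProg, predictProg, updateProg⟩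

open Classical in
theorem hypothesisMistakes_cons {V : Type*} (H : Set V) (v : V) (y : Bool) (S : List (V × Bool)) :
    hypothesisMistakes H ((v, y) :: S)
      = hypothesisMistakes H S + if decide (v ∈ H) = y then 0 else 1 := by
  unfold hypothesisMistakes
  rw [List.countP_cons]
  by_cases h : decide (v ∈ H) = y <;> simp [h]

/-- Summation of `Winnow.potential_step` over the rounds, with `Winnow.sum_exponents_le` bounding
the final exponents. H and K come after m because the algorithm does not know them. -/
theorem winnowAlgorithm_plays {n : ℕ} (hn : 0 < n) {T : ℕ → ℕ} (hT : ∀ k, T k ≤ 1) {τ : ℕ}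
    (hτ : predictTime n + updateTime n ≤ τ) (S : List (Fin n × Bool)) {e : ℕ → ℕ} {σ : State}
    (hσ : RoundInv n T e σ) (he : ∀ k < n * n, 2 ^ e k ≤ 4 * (n * n)) :
    ∃ m, winnowAlgorithm.Plays τ σ S m ∧ ∀ (H : Set (Fin n)) (K : Finset ℕ),
      (∀ k ∈ K, k < n * n) → (∀ v : Fin n, v ∈ H ↔ ∃ k ∈ K, attributes n T v k = true) →
      n * n * m + 5 * (n * n) * ∑ k ∈ K, e k
        ≤ 2 * (∑ k ∈ Finset.range (n * n), 2 ^ e k)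
          + 5 * (n * n) * (K.card * Nat.log 2 (4 * (n * n)))
          + 5 * (n * n) * (K.card + 1) * hypothesisMistakes H S := by
  induction S generalizing e σ with
  | nil =>
    refine ⟨0, rfl, fun H K hK _ => ?_⟩
    have := Nat.mul_le_mul_left (5 * (n * n)) (Winnow.sum_exponents_le hK he)
    omega
  | cons r S ih =>
    obtain ⟨v, y⟩ := r
    obtain ⟨t₁, σ₁, h₁, ht₁, hσ₁, hv, h2, hp⟩ :=
      runs_predictProg hn (hσ.setVar (x := 1) one_ne_zero v) hT he v (by simp)
    obtain ⟨t₂, σ₂, h₂, ht₂, hσ₂⟩ :=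
      runs_updateProg (hσ₁.setVar (x := 3) (by norm_num) y.toNat) hT he v (by simpa using hv) y
        (by simp) (by simpa using h2) (by simpa using hp)
    obtain ⟨l, hl, hbound⟩ := ih hσ₂ (Winnow.pow_step_le he)
    refine ⟨_, ⟨σ₁, σ₂, t₁, t₂, l, h₁, h₂, by omega, hl, rfl⟩, fun H K hK hH => ?_⟩
    have hb := hbound H K hK hH
    have hs := Winnow.potential_step (N := n * n) (e := e) (x := attributes n T v) (y := y) (K := K)
    rw [hp, hypothesisMistakes_cons]
    have hHv : decide (∃ k ∈ K, attributes n T v k = true) = y ↔ @decide (v ∈ H)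
        (Classical.propDecidable _) = y := by
      rw [decide_eq_decide.2 (hH v).symm]
    simp only [hHv] at hs
    rw [mul_add, mul_add]
    omega

/-- The table of shadows represents every halfspace as a disjunction of at most `ω` attributes. -/
theorem exists_attributes_cover {n : ℕ} {G : SimpleGraph (Fin n)} (hG : G.Connected) {σ : State}
    (hσ : TableInv G n σ) {H : Set (Fin n)} (hH : G.IsMHalfspace H) :
    ∃ K : Finset ℕ, K.card ≤ G.cliqueNum ∧ (∀ k ∈ K, k < n * n) ∧
      ∀ v : Fin n, v ∈ H ↔ ∃ k ∈ K, attributes n (σ.arr 1) v k = true := by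
  obtain ⟨K, hcard, hsound, hcomplete⟩ := hH.exists_shadow_cover hG
  refine ⟨K.image fun c => (c.1 : ℕ) * n + c.2, Finset.card_image_le.trans hcard, ?_, fun v => ?_⟩
  · intro k hk
    obtain ⟨c, -, rfl⟩ := Finset.mem_image.1 hk
    exact digit_lt c.1.2 c.2.2
  · constructor
    · intro hv
      obtain ⟨c, hc, hl⟩ := hcomplete v hv
      rw [Fintype.card_fin] at hl
      exact ⟨_, Finset.mem_image.2 ⟨c, hc, rfl⟩, decide_eq_true (hσ.complete c.1 c.2 v hl)⟩
    · rintro ⟨k, hk, hv⟩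
      obtain ⟨c, hc, rfl⟩ := Finset.mem_image.1 hk
      obtain ⟨s, hs⟩ := hσ.sound c.1 c.2 v (of_decide_eq_true hv)
      exact hsound c hc s v hs

theorem exists_polynomial_time :
    ∃ p : Polynomial ℕ, ∀ n, p.eval n = setupTime n + (predictTime n + updateTime n) := by
  let V : Polynomial ℕ :=
    4 * Polynomial.X ^ 4 + Polynomial.X ^ 3 + 4 * Polynomial.X ^ 2 + Polynomial.X + 5
  let loop (N : Polynomial ℕ) (c : ℕ) (B : Polynomial ℕ) : Polynomial ℕ :=
    N * (B + ((c + 5 : ℕ) : Polynomial ℕ) * (V + 1) + 2)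
      + ((c + 2 : ℕ) : Polynomial ℕ) * (V + 1) + 3
  have hV : ∀ n, V.eval n = valueBound n := fun n => by simp [V, valueBound]
  have hloop : ∀ N c B n, (loop N c B).eval n = loopBound (N.eval n) c (B.eval n) (valueBound n) :=
    fun N c B n => by
      simp only [loop, loopBound, Polynomial.eval_add, Polynomial.eval_mul, Polynomial.eval_natCast,
        Polynomial.eval_one, Polynomial.eval_ofNat, hV, Nat.cast_id]
  let X : Polynomial ℕ := Polynomial.X
  refine ⟨loop X 1 (loop (X * X * X * X) 7 (100 * (V + 1) + 20))
    + ((2 * (V + 1) + loop (X * X) 3 (20 * (V + 1)) + 20 * (V + 1))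
      + loop (X * X) 3 (60 * (V + 1))), fun n => ?_⟩
  simp only [Polynomial.eval_add, Polynomial.eval_mul, hloop, hV, X, Polynomial.eval_X,
    Polynomial.eval_one, Polynomial.eval_ofNat, setupTime, sweepTime, predictTime, updateTime]

/-- For n ≥ 2 one has log(4n²) ≤ 4 log n, and 4 / log 2 < 6. -/
theorem log_four_mul_sq_le {n : ℕ} (hn : 2 ≤ n) :
    (Nat.log 2 (4 * (n * n)) : ℝ) ≤ 6 * Real.log n := by
  have hn' : (2 : ℝ) ≤ n := by exact_mod_cast hn
  have hlog : Real.log 2 ≤ Real.log n := Real.log_le_log (by norm_num) hn'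
  have hlog2 := Real.log_two_gt_d9
  have hpow : (2 : ℝ) ^ Nat.log 2 (4 * (n * n)) ≤ 4 * (n * n) := by
    exact_mod_cast Nat.pow_log_le_self 2 (by positivity)
  have h := Real.log_le_log (by positivity) hpow
  rw [Real.log_pow, Real.log_mul (by norm_num) (by positivity),
    Real.log_mul (by positivity) (by positivity), show (4 : ℝ) = 2 ^ 2 by norm_num,
    Real.log_pow] at h
  push_cast at h
  have h0 : (0 : ℝ) ≤ Nat.log 2 (4 * (n * n)) := Nat.cast_nonneg _
  nlinarith

theorem mainTheorem10 :
    ∃ (A : OnlineAlgorithm) (p : Polynomial ℕ) (C : ℝ),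
      ∀ (n : ℕ), 2 ≤ n → ∀ G : SimpleGraph (Fin n), G.Connected →
        ∃ (t : ℕ) (σ : RAM.State),
          RAM.Exec A.setup (graphInput G) t σ ∧ t ≤ p.eval n ∧
          ∀ S : List (Fin n × Bool),
            ∃ k : ℕ, A.Plays (p.eval n) σ S k ∧
              (k : ℝ) ≤ C * ((G.cliqueNum : ℝ) * ((optMistakes G S : ℝ) + Real.log n)) := by
  obtain ⟨p, hp⟩ := exists_polynomial_time
  -- The count is at most 2 + 30 ω log n + 10 ω M*, and 2 ≤ 3 log n; so 33 would do.
  refine ⟨winnowAlgorithm, p, 40, fun n hn G hG => ?_⟩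
  have hn0 : 0 < n := by omega
  obtain ⟨t, σ, hexec, ht, hσ⟩ := runs_setupProg G
  refine ⟨t, σ, hexec, by rw [hp]; omega, fun S => ?_⟩
  -- Array 2 is still zero, which encodes weight 1 for every attribute.
  have hround : RoundInv n (σ.arr 1) (fun _ => 0) σ :=
    ⟨hσ.size, rfl, fun k _ => by simp [hσ.weights k]⟩
  have hnn : 0 < n * n := Nat.mul_pos hn0 hn0
  obtain ⟨m, hplays, hbound⟩ := winnowAlgorithm_plays hn0 hσ.le_one (τ := p.eval n)
    (by rw [hp]; omega) S hround (fun k _ => by rw [pow_zero]; omega)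
  refine ⟨m, hplays, ?_⟩
  obtain ⟨H, hH, hopt⟩ := exists_hypothesisMistakes_eq_optMistakes G S
  obtain ⟨K, hcard, hK, hmem⟩ := exists_attributes_cover hG hσ hH
  have hb := hbound H K hK hmem
  rw [hopt] at hb
  simp only [Finset.sum_const_zero, mul_zero, add_zero, pow_zero, Finset.sum_const,
    Finset.card_range, smul_eq_mul, mul_one] at hb
  -- Division by N; the initial total weight N leaves the summand 2.
  have hm : m ≤ 2 + 5 * (K.card * Nat.log 2 (4 * (n * n))) + 5 * (K.card + 1) * optMistakes G S :=
    Nat.le_of_mul_le_mul_left (hb.trans (le_of_eq (by ring))) hnn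
  have hω : 1 ≤ G.cliqueNum := by
    have : G.IsClique (({⟨0, hn0⟩} : Finset (Fin n)) : Set (Fin n)) := by simp
    simpa using this.card_le_cliqueNum
  have hn' : (2 : ℝ) ≤ n := by exact_mod_cast hn
  have hlog : Real.log 2 ≤ Real.log n := Real.log_le_log (by norm_num) hn'
  have hlog2 := Real.log_two_gt_d9
  have hL := log_four_mul_sq_le hn
  -- Here |K| + 1 ≤ ω + ω, as ω ≥ 1.
  have hm' : m ≤ 2 + 5 * (G.cliqueNum * Nat.log 2 (4 * (n * n)))
      + 5 * (G.cliqueNum + G.cliqueNum) * optMistakes G S := by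
    refine hm.trans ?_
    gcongr
  have hmR : (m : ℝ) ≤ 2 + 5 * (G.cliqueNum * Nat.log 2 (4 * (n * n)))
      + 5 * (G.cliqueNum + G.cliqueNum) * optMistakes G S := by
    exact_mod_cast hm'
  have hωR : (1 : ℝ) ≤ G.cliqueNum := by exact_mod_cast hω
  have h₁ : (G.cliqueNum : ℝ) * Nat.log 2 (4 * (n * n)) ≤ G.cliqueNum * (6 * Real.log n) :=
    mul_le_mul_of_nonneg_left hL (by positivity)
  have h₂ : 1 * Real.log n ≤ G.cliqueNum * Real.log n :=
    mul_le_mul_of_nonneg_right hωR (by linarith)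
  have h₃ : (0 : ℝ) ≤ G.cliqueNum * optMistakes G S := by positivity
  linarith
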